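/- **Theorem 1.1.** Let $P=\{p_1,\dots,p_d\}$ and $Q=\{q_1,\dots,q_d\}$ be finite posets with $d$ elements each, and let $K$ be a field. Let $\mathcal J(P)$, $\mathcal J(Q)$ denote the sets of poset ideals (down-closed subsets, including $\emptyset$), and for $J\in\mathcal J(Q)$ let $\max(J)$ be the antichain of maximal elements of $J$. For $I\subseteq P$ put $\rho(I)=\sum_{p_i\in I}\mathbf e_i\in\mathbb R^d$, and for $A\subseteq Q$ put $\rho(A)=\sum_{q_i\in A}\mathbf e_i$. Let $\mathcal O(P)$ be the convex hull of $\{\rho(I): I\in\mathcal J(P)\}$, let $\mathcal C(Q)$ be the convex hull of $\{\rho(A): A \text{ an antichain of } Q\}$, and let $\Gamma=\Gamma(\mathcal O(P),-\mathcal C(Q))$ be the convex hull of $\mathcal O(P)\cup(-\mathcal C(Q))$. Let $K[\Gamma]\subseteq K[t_1^{\pm1},\dots,t_d^{\pm1},s]$ be the $K$-subalgebra generated by the monomials $\mathbf t^{\alpha}s$ with $\alpha\in\Gamma\cap\mathbb Z^d$. Let $K[\mathbf x,\mathbf y,z]$ be the polynomial ring in the variables $x_I$ ($\emptyset\ne I\in\mathcal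 J(P)$), $y_{\max(J)}$ ($\emptyset\neq J\in\mathcal J(Q)$) and $z$, and let $\pi:K[\mathbf x,\mathbf y,z]\to K[\Gamma]$ be the $K$-algebra homomorphism with $\pi(x_I)=\mathbf t^{\rho(I)}s$, $\pi(y_{\max(J)})=\mathbf t^{-\rho(\max(J))}s$, $\pi(z)=s$. Then $\pi$ is surjective; its kernel $I_\Gamma$ is the toric ideal of $\Gamma$. Linear orders of the variables such that, for all nonempty $I,I'\in\mathcal J(P)$ and $J,J'\in\mathcal J(Q)$, - $z<y_{\max(J)}<x_I$, - $x_{I'}<x_I$ if $I'\subsetneq I$, - $y_{\max(J')}<y_{\max(J)}$ if $J'\subsetneq J$ exist. Let $<$ be the (graded) reverse lexicographic order on the monomials of $K[\mathbf x,\mathbf y,z]$ induced by any such linear order of the variables. With the convention $x_\emptyset=y_\emptyset=z$, let $\mathcal G$ be the set of the binomials 1. $x_Ix_{I'}-x_{I\cup I'}x_{I\cap I'}$, where $I,I'\in\mathcal J(P)$ are incomparable under inclusion; 2. $y_{\max(J)}y_{\max(J')}-y_{\max(J\cup J')}y_{\max(J*J')}$, where $J,J'\in\mathcal J(Q)$ are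 incomparable under inclusion and $J*J'$ is the poset ideal of $Q$ generated by $\max(J\cap J')\cap(\max(J)\cup\max(J'))$; 3. $x_Iy_{\max(J)}-x_{I\setminus\{p_i\}}\,y_{\max(J)\setminus\{q_i\}}$, where $I\in\mathcal J(P)$, $J\in\mathcal J(Q)$, $1\le i\le d$, $p_i$ is a maximal element of $I$ and $q_i$ is a maximal element of $J$. Then $\mathcal G$ is a Gröbner basis of $I_\Gamma$ with respect to $<$: it is a finite set of nonzero elements of $I_\Gamma$ whose initial monomials generate the initial ideal $\mathrm{in}_<(I_\Gamma)$. In particular, $\mathrm{in}_<(I_\Gamma)$ is generated by squarefree quadratic monomials. -/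

import Mathlib

/-! ## The reverse lexicographic order -/

/-- Type synonym for the monomials (exponent vectors) in variables indexed by `σ`, which will carry
the (graded) reverse lexicographic order induced by the linear order `ord` of the variables. -/
def DegRevLex (σ : Type*) (_ord : LinearOrder σ) : Type _ := σ →₀ ℕ

namespace DegRevLex

variable {σ : Type*} (ord : LinearOrder σ)

noncomputable instance : AddCommMonoid (DegRevLex σ ord) :=
  inferInstanceAs (AddCommMonoid (σ →₀ ℕ))

/-- The underlying exponent vector. -/
def exps (a : DegRevLex σ ord) : σ →₀ ℕ := a

theorem exps_add (a b : DegRevLex σ ord) : exps ord (a + b) = exps ord a + exps ord b := rfl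

/-- The sorting key: first the total degree, then the reversed lexicographic order,
in which the smallest variable is compared first. -/
noncomputable def key (a : DegRevLex σ ord) : ℕ ×ₗ (Lex (σ →₀ ℕ))ᵒᵈ :=
  toLex ((exps ord a).degree, OrderDual.toDual (toLex (exps ord a)))

noncomputable instance : LinearOrder (DegRevLex σ ord) :=
  LinearOrder.lift' (key ord) fun _ _ h =>
    congrArg (fun w : ℕ ×ₗ (Lex (σ →₀ ℕ))ᵒᵈ => ofLex (OrderDual.ofDual (ofLex w).2)) h

theorem le_iff (a b : DegRevLex σ ord) : a ≤ b ↔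
    (exps ord a).degree < (exps ord b).degree ∨ ((exps ord a).degree = (exps ord b).degree ∧
      toLex (exps ord b) ≤ toLex (exps ord a)) := by
  change key ord a ≤ key ord b ↔ _
  simp only [key, Prod.Lex.toLex_le_toLex, OrderDual.toDual_le_toDual]

theorem lt_iff (a b : DegRevLex σ ord) : a < b ↔
    (exps ord a).degree < (exps ord b).degree ∨ ((exps ord a).degree = (exps ord b).degree ∧
      toLex (exps ord b) < toLex (exps ord a)) := by
  change key ord a < key ord b ↔ _
  simp only [key, Prod.Lex.toLex_lt_toLex, OrderDual.toDual_lt_toDual]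

instance : IsOrderedAddMonoid (DegRevLex σ ord) where
  add_le_add_left a b h c := by
    rw [le_iff] at h ⊢
    simp only [exps_add, map_add, toLex_add]
    rcases h with h | ⟨h1, h2⟩
    · exact Or.inl (Nat.add_lt_add_right h _)
    · exact Or.inr ⟨congrArg (· + _) h1, add_le_add_left h2 _⟩

instance [Finite σ] : WellFoundedLT (DegRevLex σ ord) := by
  have hfin : ∀ n : ℕ, {a : DegRevLex σ ord | (exps ord a).degree ≤ n}.Finite := fun n => by
    have := Fintype.ofFinite σ
    refine Set.Finite.subset (Set.finite_Iic (Finsupp.equivFunOnFinite.symm fun _ => n)) ?_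
    intro a ha i
    exact (Finsupp.le_degree i (exps ord a)).trans ha
  refine ⟨RelEmbedding.wellFounded_iff_isEmpty.mpr ⟨fun f => ?_⟩⟩
  have hanti : StrictAnti f := fun m n hmn => f.map_rel_iff.mpr hmn
  refine Set.infinite_range_of_injective hanti.injective ((hfin (exps ord (f 0)).degree).subset ?_)
  rintro _ ⟨n, rfl⟩
  rcases (le_iff ord _ _).mp (hanti.antitone (Nat.zero_le n)) with h | h
  · exact h.le
  · exact h.1.le

end DegRevLex

/-- The (graded) reverse lexicographic order on the monomials in finitely many variables, induced by
the linear order `ord` of the variables: `i < j` in `ord` means that the variable `i` is smaller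
than the variable `j`. See `degRevLex_lt_iff`. -/
noncomputable def degRevLex {σ : Type*} [Finite σ] (ord : LinearOrder σ) : MonomialOrder σ where
  syn := DegRevLex σ ord
  toSyn := { toEquiv := Equiv.refl _, map_add' := fun _ _ => rfl }
  toSyn_monotone a b h := by
    obtain ⟨c, rfl⟩ := le_iff_exists_add.mp h
    refine (DegRevLex.le_iff ord _ _).mpr ?_
    change Finsupp.degree a < Finsupp.degree (a + c) ∨ Finsupp.degree a = Finsupp.degree (a + c) ∧
      toLex (a + c) ≤ toLex a
    rw [map_add]
    rcases Nat.eq_zero_or_pos (Finsupp.degree c) with h0 | h0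
    · right
      have : c = 0 := (Finsupp.degree_eq_zero_iff c).mp h0
      subst this
      simp
    · left; omega

/-- Among two monomials of the same degree, the smaller one is the one with the larger exponent at
the smallest variable at which the two differ. -/
theorem degRevLex_lt_iff {σ : Type*} [Finite σ] (ord : LinearOrder σ) (a b : σ →₀ ℕ) :
    (degRevLex ord).toSyn a < (degRevLex ord).toSyn b ↔
      a.degree < b.degree ∨ (a.degree = b.degree ∧
        ∃ i, (∀ j, ord.lt j i → a j = b j) ∧ b i < a i) := by
  refine (DegRevLex.lt_iff ord _ _).trans ?_
  refine or_congr Iff.rfl (and_congr Iff.rfl ?_)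
  rw [Finsupp.Lex.lt_iff]
  exact exists_congr fun i => and_congr (forall_congr' fun j => imp_congr Iff.rfl eq_comm) Iff.rfl

/-! ## Initial ideals and Gröbner bases -/

section Groebner

variable {σ K : Type*} [Field K]

/-- The ideal generated by the initial monomials of the nonzero polynomials in a set `S`. For an
ideal `S = I` this is the initial ideal of `I`. -/
noncomputable def initialIdeal (m : MonomialOrder σ) (S : Set (MvPolynomial σ K)) :
    Ideal (MvPolynomial σ K) :=
  Ideal.span {f | ∃ g ∈ S, g ≠ 0 ∧ f = MvPolynomial.monomial (m.degree g) (1 : K)}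

/-- `G` is a Gröbner basis of the ideal `I` with respect to the monomial order `m`: a finite set
of nonzero polynomials of `I` whose initial monomials generate the initial ideal of `I`. -/
structure IsGroebnerBasis (m : MonomialOrder σ) (G : Set (MvPolynomial σ K))
    (I : Ideal (MvPolynomial σ K)) : Prop where
  finite : G.Finite
  ne_zero : ∀ g ∈ G, g ≠ 0
  subset : G ⊆ (I : Set (MvPolynomial σ K))
  initialIdeal_eq : initialIdeal m G = initialIdeal m (I : Set (MvPolynomial σ K))

/-- The ideal `I` is generated by squarefree quadratic monomials. -/
def IsSquarefreeQuadraticMonomialIdeal (I : Ideal (MvPolynomial σ K)) : Prop :=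
  ∃ S : Set (σ →₀ ℕ), (∀ a ∈ S, a.degree = 2 ∧ ∀ v, a v ≤ 1) ∧
    I = Ideal.span ((fun a => MvPolynomial.monomial a (1 : K)) '' S)

end Groebner

/-! ## Poset ideals and antichains

Poset ideals are Mathlib's `LowerSet`s; the empty poset ideal is `⊥`. -/

/-- The set of antichains of a poset. -/
abbrev Antichain (Q : Type*) [PartialOrder Q] : Type _ :=
  {A : Set Q // IsAntichain (· ≤ ·) A}

section Posets

variable {P Q : Type*} [PartialOrder P] [PartialOrder Q]

/-- The antichain `max J` of the maximal elements of a poset ideal `J`. -/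
def maxAntichain (J : LowerSet Q) : Antichain Q :=
  ⟨{a | Maximal (· ∈ J) a}, setOfPred_maximal_antichain _⟩

/-- The poset ideal `I ∖ {a}`, for a maximal element `a` of the poset ideal `I`. -/
def eraseMaximal (I : LowerSet P) (a : P) (ha : Maximal (· ∈ I) a) : LowerSet P where
  carrier := (I : Set P) \ {a}
  lower' := by
    rintro b c hcb ⟨hb, hba⟩
    refine ⟨I.lower hcb hb, ?_⟩
    rintro rfl
    exact hba (le_antisymm (ha.2 hb hcb) hcb)

/-- The antichain `A ∖ {a}`. -/
def eraseAntichain (A : Antichain Q) (a : Q) : Antichain Q :=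
  ⟨A.1 \ {a}, A.2.subset Set.sdiff_subset⟩

/-- `J * J'`: the poset ideal generated by `max (J ∩ J') ∩ (max J ∪ max J')`. -/
def starIdeal (J J' : LowerSet Q) : LowerSet Q :=
  lowerClosure ((maxAntichain (J ⊓ J')).1 ∩ ((maxAntichain J).1 ∪ (maxAntichain J').1))

end Posets

/-! ## The variables -/

/-- The variables: `x I` for the nonempty poset ideals `I` of `P`, `y A` for the nonempty
antichains `A` of `Q` (that is, `A = max J` for a nonempty poset ideal `J` of `Q`), and `z`. -/
inductive ToricVar (P Q : Type*) [PartialOrder P] [PartialOrder Q] : Type _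
  | x (I : LowerSet P) (hI : I ≠ ⊥) : ToricVar P Q
  | y (A : Antichain Q) (hA : A.1.Nonempty) : ToricVar P Q
  | z : ToricVar P Q

section Variables

variable {P Q : Type*} [PartialOrder P] [PartialOrder Q]

instance [Finite P] [Finite Q] : Finite (ToricVar P Q) := by
  have : Finite (LowerSet P) := Finite.of_injective (fun I : LowerSet P => (I : Set P))
    SetLike.coe_injective
  let f : ToricVar P Q → Option (LowerSet P ⊕ Antichain Q) := fun v =>
    match v with
    | .x I _ => some (Sum.inl I)
    | .y A _ => some (Sum.inr A)
    | .z => none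
  refine Finite.of_injective f ?_
  rintro (⟨I, hI⟩ | ⟨A, hA⟩ | _) (⟨I', hI'⟩ | ⟨A', hA'⟩ | _) h <;> simp_all [f]

variable (Q) in
open Classical in
/-- The variable `x_I`, with the convention `x_∅ = z`. -/
noncomputable def xVar (I : LowerSet P) : ToricVar P Q :=
  if h : I = ⊥ then .z else .x I h

variable (P) in
open Classical in
/-- The variable `y_A`, with the convention `y_∅ = z`. -/
noncomputable def yVar (A : Antichain Q) : ToricVar P Q :=
  if h : A.1.Nonempty then .y A h else .z

/-- The conditions on the order of the variables. -/
structure IsAdmissibleOrder (ord : LinearOrder (ToricVar P Q)) : Prop where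
  z_lt_y : ∀ J : LowerSet Q, J ≠ ⊥ → ord.lt .z (yVar P (maxAntichain J))
  y_lt_x : ∀ (J : LowerSet Q) (I : LowerSet P), J ≠ ⊥ → I ≠ ⊥ →
    ord.lt (yVar P (maxAntichain J)) (xVar Q I)
  x_lt_x : ∀ I' I : LowerSet P, I' ≠ ⊥ → I ≠ ⊥ → I' < I → ord.lt (xVar Q I') (xVar Q I)
  y_lt_y : ∀ J' J : LowerSet Q, J' ≠ ⊥ → J ≠ ⊥ → J' < J →
    ord.lt (yVar P (maxAntichain J')) (yVar P (maxAntichain J))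

end Variables

/-! ## The polytope -/

section Polytope

variable {d : ℕ} {P Q : Type*} [PartialOrder P] [PartialOrder Q]

open Classical in
/-- `ρ(I) = ∑_{p_i ∈ I} e_i`, for a subset `I` of `P = {p_1, …, p_d}`. -/
noncomputable def rho (p : Fin d ≃ P) (I : Set P) : Fin d → ℤ :=
  fun i => if p i ∈ I then 1 else 0

/-- The inclusion of `ℤ^d` in `ℝ^d`. -/
def toRealVec (α : Fin d → ℤ) : Fin d → ℝ := fun i => (α i : ℝ)

/-- The order polytope `O(P)`. -/
def orderPolytope (p : Fin d ≃ P) : Set (Fin d → ℝ) :=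
  convexHull ℝ (Set.range fun I : LowerSet P => toRealVec (rho p I))

/-- The chain polytope `C(Q)`. -/
def chainPolytope (q : Fin d ≃ Q) : Set (Fin d → ℝ) :=
  convexHull ℝ (Set.range fun A : Antichain Q => toRealVec (rho q A.1))

/-- `Γ(O(P), -C(Q))`, the convex hull of `O(P) ∪ (-C(Q))`. -/
def gammaPolytope (p : Fin d ≃ P) (q : Fin d ≃ Q) : Set (Fin d → ℝ) :=
  convexHull ℝ (orderPolytope p ∪ Neg.neg '' chainPolytope q)

end Polytope

/-! ## The toric ring and the toric ideal -/

section Toric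

/-- The ring `K[t_1^{±1}, …, t_d^{±1}, s]`, as the algebra of the monoid `ℤ^d × ℕ`. -/
abbrev LaurentRing (K : Type*) [Field K] (d : ℕ) : Type _ :=
  AddMonoidAlgebra K ((Fin d → ℤ) × ℕ)

/-- The Laurent monomial `t^α s`. -/
noncomputable def laurentMonomial (K : Type*) [Field K] {d : ℕ} (α : Fin d → ℤ) :
    LaurentRing K d :=
  AddMonoidAlgebra.single (α, 1) 1

/-- The toric ring of a polytope: the subring generated over `K` by the monomials `t^α s` with
`α` a lattice point of the polytope. -/
noncomputable def toricRing (K : Type*) [Field K] {d : ℕ} (S : Set (Fin d → ℝ)) :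
    Subalgebra K (LaurentRing K d) :=
  Algebra.adjoin K (laurentMonomial K '' {α : Fin d → ℤ | toRealVec α ∈ S})

variable {d : ℕ} {P Q : Type*} [PartialOrder P] [PartialOrder Q]

/-- The lattice point of `Γ(O(P), -C(Q))` to which a variable corresponds. -/
noncomputable def varPoint (p : Fin d ≃ P) (q : Fin d ≃ Q) : ToricVar P Q → (Fin d → ℤ)
  | .x I _ => rho p I
  | .y A _ => -rho q A.1
  | .z => 0

theorem varPoint_mem (p : Fin d ≃ P) (q : Fin d ≃ Q) (v : ToricVar P Q) :
    toRealVec (varPoint p q v) ∈ gammaPolytope p q := by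
  apply subset_convexHull
  rcases v with ⟨I, hI⟩ | ⟨A, hA⟩ | _
  · exact Or.inl (subset_convexHull _ _ ⟨I, rfl⟩)
  · refine Or.inr ⟨_, subset_convexHull _ _ ⟨A, rfl⟩, ?_⟩
    funext i
    simp [varPoint, toRealVec]
  · refine Or.inl (subset_convexHull _ _ ⟨⊥, ?_⟩)
    funext i
    simp [varPoint, toRealVec, rho]

/-- The ring homomorphism `π` from `K[x, y, z]` to the toric ring of `Γ(O(P), -C(Q))`:
`π(x_I) = t^{ρ(I)} s`, `π(y_A) = t^{-ρ(A)} s`, `π(z) = s`. -/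
noncomputable def toricMap (K : Type*) [Field K] (p : Fin d ≃ P) (q : Fin d ≃ Q) :
    MvPolynomial (ToricVar P Q) K →ₐ[K] toricRing K (gammaPolytope p q) :=
  MvPolynomial.aeval fun v =>
    ⟨laurentMonomial K (varPoint p q v),
      Algebra.subset_adjoin ⟨varPoint p q v, varPoint_mem p q v, rfl⟩⟩

/-- The toric ideal of `Γ(O(P), -C(Q))`. -/
noncomputable def toricIdeal (K : Type*) [Field K] (p : Fin d ≃ P) (q : Fin d ≃ Q) :
    Ideal (MvPolynomial (ToricVar P Q) K) :=
  RingHom.ker (toricMap K p q)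

/-! ## The binomials -/

/-- The polynomial `x_I`, with `x_∅ = z`. -/
noncomputable def polyX (K : Type*) [Field K] (Q : Type*) [PartialOrder Q] (I : LowerSet P) :
    MvPolynomial (ToricVar P Q) K :=
  MvPolynomial.X (xVar Q I)

/-- The polynomial `y_A`, with `y_∅ = z`. -/
noncomputable def polyY (K : Type*) [Field K] (P : Type*) [PartialOrder P] (A : Antichain Q) :
    MvPolynomial (ToricVar P Q) K :=
  MvPolynomial.X (yVar P A)

/-- The binomials `x_I x_{I'} - x_{I ∪ I'} x_{I ∩ I'}` with `I`, `I'` incomparable. -/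
def binomialsX (K : Type*) [Field K] (P Q : Type*) [PartialOrder P] [PartialOrder Q] :
    Set (MvPolynomial (ToricVar P Q) K) :=
  {f | ∃ I I' : LowerSet P, ¬ I ≤ I' ∧ ¬ I' ≤ I ∧
    f = polyX K Q I * polyX K Q I' - polyX K Q (I ⊔ I') * polyX K Q (I ⊓ I')}

/-- The binomials `y_{max J} y_{max J'} - y_{max (J ∪ J')} y_{max (J * J')}` with `J`, `J'`
incomparable. -/
def binomialsY (K : Type*) [Field K] (P Q : Type*) [PartialOrder P] [PartialOrder Q] :
    Set (MvPolynomial (ToricVar P Q) K) :=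
  {f | ∃ J J' : LowerSet Q, ¬ J ≤ J' ∧ ¬ J' ≤ J ∧
    f = polyY K P (maxAntichain J) * polyY K P (maxAntichain J') -
      polyY K P (maxAntichain (J ⊔ J')) * polyY K P (maxAntichain (starIdeal J J'))}

/-- The binomials `x_I y_{max J} - x_{I ∖ {p_i}} y_{max J ∖ {q_i}}` with `p_i` maximal in `I` and
`q_i` maximal in `J`. -/
def binomialsXY (K : Type*) [Field K] (p : Fin d ≃ P) (q : Fin d ≃ Q) :
    Set (MvPolynomial (ToricVar P Q) K) :=
  {f | ∃ (I : LowerSet P) (J : LowerSet Q) (i : Fin d) (hI : Maximal (· ∈ I) (p i))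
      (_ : Maximal (· ∈ J) (q i)),
    f = polyX K Q I * polyY K P (maxAntichain J) -
      polyX K Q (eraseMaximal I (p i) hI) * polyY K P (eraseAntichain (maxAntichain J) (q i))}

/-- The set `𝒢` of all these binomials. -/
def binomialsG (K : Type*) [Field K] (p : Fin d ≃ P) (q : Fin d ≃ Q) :
    Set (MvPolynomial (ToricVar P Q) K) :=
  binomialsX K P Q ∪ binomialsY K P Q ∪ binomialsXY K p q

end Toric

/-!
A monomial `u` in the variables records a family of poset ideals `I` of `P` (its factors `x_I`)
and a family of poset ideals `J` of `Q` (its factors `y_{max J}`). Write `f` for the function on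
`P` counting the members `I` through a point (`cover`), and `g` for the function on `Q` counting the
members `J` in which a point is maximal (`peak`). Under `π` the monomial `u` goes to
`t^{f - g} s^n`, where `n` is its degree.

The binomials of `𝒢` have the initial monomials `x_I x_{I'}`, `y_{max J} y_{max J'}` with
incomparable indices, and `x_I y_{max J}` with a common `i` such that `p_i`, `q_i` are maximal in
`I`, `J`: in each case the trailing monomial contains a variable smaller than both variables of the
initial one (`BinomialMove.lt`). A monomial divisible by none of these is called standard. For a
standard monomial the ideals `I` form a chain, so do the ideals `J`, and at every index `i` either
`f` does not exceed its largest value `f⁺` strictly above `p_i`, or `g` vanishes at `q_i`. Hence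
`f = max (f - g) f⁺`, so that `f - g` determines `f` by recursion from the top of `P`
(`cover_eq_of_sub_eq`), and then `g`. In a chain of ideals of `Q`, the same recursion
`cover = peak + (largest cover strictly above)` recovers the covering numbers from `g`
(`cover_eq_of_peak_eq`), and a chain of nonempty ideals is recovered from its covering numbers
(`ChainSupported.eq_of_cover_eq`). So distinct standard monomials have distinct images
(`IsStandard.eq_of_imageExponent_eq`).

Replacing initial by trailing monomials reaches, from any monomial, a standard one below it with the
same image (`exists_isStandard_le`). If the initial monomial `u` of some `f ≠ 0` in the toric ideal
were standard, then `f` would contain a second monomial `v < u` with the same image, whose standard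
monomial would have to be `u`; but it is at most `v` (`not_isStandard_degree`).

For surjectivity, a lattice point of the polytope that lies strictly between the order polytope and
the negative of the chain polytope has coordinates of absolute value less than one, so it is `0`;
the others are lattice points of one of the two, whose inequalities identify them with poset ideals
and antichains (`exists_varPoint_eq_of_mem_gammaPolytope`).
-/

/-! ### Families of poset ideals with multiplicities -/

section CoverPeak

open Finset

variable {σ α : Type*} [Fintype σ] [PartialOrder α]

open Classical in
/-- The number of members of the family `F` of poset ideals, counted with multiplicities `w`,
that contain `x`. -/
noncomputable def cover (F : σ → LowerSet α) (w : σ → ℕ) (x : α) : ℕ :=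
  ∑ v with x ∈ F v, w v

open Classical in
/-- The number of members of the family `F` of poset ideals, counted with multiplicities `w`,
in which `x` is a maximal element. -/
noncomputable def peak (F : σ → LowerSet α) (w : σ → ℕ) (x : α) : ℕ :=
  ∑ v with Maximal (· ∈ F v) x, w v

/-- The members of `F` of positive multiplicity form a chain. -/
def ChainSupported (F : σ → LowerSet α) (w : σ → ℕ) : Prop :=
  ∀ v v', w v ≠ 0 → w v' ≠ 0 → F v ≤ F v' ∨ F v' ≤ F v

variable {F : σ → LowerSet α} {w w' : σ → ℕ}

open Classical in
/-- The members of a chain that meet `S` are those that contain the element of `S` covered most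
often. -/
theorem ChainSupported.sum_meets_eq_sup_cover (h : ChainSupported F w) (S : Finset α) :
    (∑ v with ∃ x ∈ S, x ∈ F v, w v) = S.sup (cover F w) := by
  refine le_antisymm ?_ (Finset.sup_le fun x hx => ?_)
  · rcases S.eq_empty_or_nonempty with rfl | hS
    · simp
    obtain ⟨x, hx, hmax⟩ := S.exists_max_image (cover F w) hS
    refine le_trans ?_ (Finset.le_sup (f := cover F w) hx)
    rw [cover, Finset.sum_filter, Finset.sum_filter]
    refine Finset.sum_le_sum fun v _ => ?_
    split_ifs with h1 h2 h2
    · exact le_rfl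
    · by_contra hv
      replace hv : w v ≠ 0 := by omega
      obtain ⟨y, hy, hyv⟩ := h1
      -- The members containing `x` all contain `y`, and so does `v`, which does not contain `x`.
      refine absurd (hmax y hy) (not_le.mpr ?_)
      rw [cover, cover, Finset.sum_filter, Finset.sum_filter]
      refine Finset.sum_lt_sum (fun u _ => ?_) ⟨v, mem_univ v, ?_⟩
      · split_ifs with hu1 hu2 hu2
        · exact le_rfl
        · by_contra hu
          rcases h u v (by omega) hv with hle | hle
          · exact h2 (hle hu1)
          · exact hu2 (hle hyv)
        · exact Nat.zero_le _
        · exact le_rfl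
      · rw [if_neg h2, if_pos hyv]
        omega
    · exact Nat.zero_le _
    · exact le_rfl
  · rw [cover]
    exact Finset.sum_le_sum_of_subset fun v hv => by
      simp only [mem_filter, mem_univ, true_and] at hv ⊢
      exact ⟨x, hx, hv⟩

open Classical in
/-- The members that contain `x`, but not as a maximal element, are those that meet the set of
elements strictly above `x`. -/
theorem ChainSupported.cover_eq [Fintype α] (h : ChainSupported F w) (x : α) :
    cover F w x = peak F w x + (univ.filter (x < ·)).sup (cover F w) := by
  rw [← h.sum_meets_eq_sup_cover, cover, peak, ← Finset.sum_filter_add_sum_filter_not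
    (univ.filter fun v => x ∈ F v) (fun v => Maximal (· ∈ F v) x), Finset.filter_filter,
    Finset.filter_filter]
  congr 2
  · ext v
    simp only [mem_filter, mem_univ, true_and]
    exact ⟨fun hv => hv.2, fun hv => ⟨hv.1, hv⟩⟩
  · ext v
    simp only [mem_filter, mem_univ, true_and]
    constructor
    · rintro ⟨hx, hmax⟩
      by_contra! hcon
      exact hmax ⟨hx, fun y hy hxy => by
        rcases hxy.eq_or_lt with rfl | hlt
        · exact le_rfl
        · exact absurd hy (hcon y hlt)⟩
    · rintro ⟨y, hxy, hy⟩
      exact ⟨(F v).lower hxy.le hy, fun hmax => hxy.not_ge (hmax.2 hy hxy.le)⟩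

theorem cover_eq_of_peak_eq [Finite α] (h : ChainSupported F w) (h' : ChainSupported F w')
    (hpeak : ∀ x, peak F w x = peak F w' x) (x : α) : cover F w x = cover F w' x := by
  classical
  have := Fintype.ofFinite α
  induction x using (Finite.to_wellFoundedGT (α := α)).wf.induction with
  | _ x ih =>
    rw [h.cover_eq, h'.cover_eq, hpeak]
    congr 1
    exact Finset.sup_congr rfl fun y hy => ih y (by simpa using hy)

/-- The key determination: `f = max (f - g) f⁺`, where `f` counts the members of `F` through `x`
and `f⁺ x` is the largest value of `f` above `x`, provided that at each place either no member of
`F` has a maximal element or `g` vanishes. Hence the difference `f - g` determines `f`. -/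
theorem cover_eq_of_sub_eq [Finite α] (h : ChainSupported F w) (h' : ChainSupported F w')
    {g g' : α → ℕ} (hg : ∀ x, peak F w x = 0 ∨ g x = 0) (hg' : ∀ x, peak F w' x = 0 ∨ g' x = 0)
    (hsub : ∀ x, (cover F w x : ℤ) - g x = cover F w' x - g' x) (x : α) :
    cover F w x = cover F w' x := by
  classical
  have := Fintype.ofFinite α
  induction x using (Finite.to_wellFoundedGT (α := α)).wf.induction with
  | _ x ih =>
    have hsup : (univ.filter (x < ·)).sup (cover F w) = (univ.filter (x < ·)).sup (cover F w') :=
      Finset.sup_congr rfl fun y hy => ih y (by simpa using hy)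
    have h1 := h.cover_eq x
    have h2 := h'.cover_eq x
    have h3 := hsub x
    have h4 := hg x
    have h5 := hg' x
    rw [hsup] at h1
    omega

open Classical in
/-- The members not contained in a poset ideal `J` are those that meet the complement of `J`, so
their number is determined by the covering numbers. Comparing `J = ∅` with `J = I` counts the
nonempty members contained in `I`. -/
theorem ChainSupported.sum_le_eq_of_cover_eq [Finite α] (h : ChainSupported F w)
    (h' : ChainSupported F w') (hc : ∀ x, cover F w x = cover F w' x) (I : LowerSet α) :
    (∑ v with F v ≤ I ∧ F v ≠ ⊥, w v) = ∑ v with F v ≤ I ∧ F v ≠ ⊥, w' v := by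
  have := Fintype.ofFinite α
  have key : ∀ J : LowerSet α, (∑ v with ¬ F v ≤ J, w v) = ∑ v with ¬ F v ≤ J, w' v := by
    intro J
    have hJ : ∀ v, ¬ F v ≤ J ↔ ∃ x ∈ univ.filter (· ∉ J), x ∈ F v := fun v => by
      rw [← LowerSet.coe_subset_coe, Set.not_subset]
      simp only [mem_filter, mem_univ, true_and, SetLike.mem_coe]
      exact exists_congr fun x => and_comm
    simp only [hJ]
    rw [h.sum_meets_eq_sup_cover, h'.sum_meets_eq_sup_cover]
    exact Finset.sup_congr rfl fun x _ => hc x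
  have split : ∀ u : σ → ℕ, (∑ v with F v ≤ I ∧ F v ≠ ⊥, u v) + (∑ v with ¬ F v ≤ I, u v) =
      ∑ v with ¬ F v ≤ ⊥, u v := by
    intro u
    rw [← Finset.sum_filter_add_sum_filter_not (univ.filter fun v => ¬ F v ≤ ⊥) (fun v => F v ≤ I),
      Finset.filter_filter, Finset.filter_filter]
    congr 2
    · ext v
      simp only [mem_filter, mem_univ, true_and, le_bot_iff]
      exact and_comm
    · ext v
      simp only [mem_filter, mem_univ, true_and]
      exact ⟨fun hv => ⟨fun hb => hv (hb.trans bot_le), hv⟩, fun hv => hv.2⟩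
  have h1 := split w
  have h2 := split w'
  rw [key I, key ⊥] at h1
  omega

/-- A family supported on a chain of nonempty poset ideals is recovered from its covering numbers;
each poset ideal is assumed to occur only once, unless it is empty. -/
theorem ChainSupported.eq_of_cover_eq [Finite α] (h : ChainSupported F w)
    (h' : ChainSupported F w') (hc : ∀ x, cover F w x = cover F w' x)
    (hF : ∀ v v', F v ≠ ⊥ → F v = F v' → v = v') (v : σ) (hv : F v ≠ ⊥) : w v = w' v := by
  classical
  have := Finite.of_injective (fun I : LowerSet α => (I : Set α)) SetLike.coe_injective
  induction hI : F v using (Finite.to_wellFoundedLT (α := LowerSet α)).wf.induction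
    generalizing v with
  | _ I ih =>
    have hsum := h.sum_le_eq_of_cover_eq h' hc I
    have hmem : v ∈ univ.filter fun u => F u ≤ I ∧ F u ≠ ⊥ := by simp [← hI, hv]
    have hrest : ∑ u ∈ (univ.filter fun u => F u ≤ I ∧ F u ≠ ⊥).erase v, w u =
        ∑ u ∈ (univ.filter fun u => F u ≤ I ∧ F u ≠ ⊥).erase v, w' u := by
      refine Finset.sum_congr rfl fun u hu => ?_
      simp only [mem_erase, mem_filter, mem_univ, true_and] at hu
      refine ih (F u) (hu.2.1.lt_of_ne fun he => hu.1 ?_) u hu.2.2 rfl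
      exact (hF v u hv (hI.trans he.symm)).symm
    rw [← Finset.sum_erase_add _ w hmem, ← Finset.sum_erase_add _ w' hmem, hrest] at hsum
    exact Nat.add_left_cancel hsum

end CoverPeak

/-! ### Poset ideals and the antichains of their maximal elements -/

section PosetIdeals

variable {Q : Type*} [PartialOrder Q]

theorem not_maximal_mem_bot (x : Q) : ¬ Maximal (· ∈ (⊥ : LowerSet Q)) x := fun h => h.1

theorem lowerClosure_maxAntichain [Finite Q] (J : LowerSet Q) :
    lowerClosure (maxAntichain J).1 = J := by
  ext x
  rw [SetLike.mem_coe, mem_lowerClosure]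
  constructor
  · rintro ⟨y, hy, hxy⟩
    exact J.lower hxy hy.1
  · intro hx
    obtain ⟨y, hxy, hy⟩ := Finite.exists_le_maximal (p := (· ∈ J)) hx
    exact ⟨y, hy, hxy⟩

theorem maximal_mem_lowerClosure_iff {A : Set Q} (hA : IsAntichain (· ≤ ·) A) (x : Q) :
    Maximal (· ∈ lowerClosure A) x ↔ x ∈ A := by
  constructor
  · rintro ⟨hx, hmax⟩
    obtain ⟨y, hy, hxy⟩ := mem_lowerClosure.mp hx
    exact le_antisymm hxy (hmax (subset_lowerClosure hy) hxy) ▸ hy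
  · intro hx
    refine ⟨subset_lowerClosure hx, fun y hy hxy => ?_⟩
    obtain ⟨z, hz, hyz⟩ := mem_lowerClosure.mp hy
    exact hyz.trans (hA.eq hx hz (hxy.trans hyz)).ge

theorem maxAntichain_lowerClosure (A : Antichain Q) : maxAntichain (lowerClosure A.1) = A :=
  Subtype.ext (Set.ext fun x => maximal_mem_lowerClosure_iff A.2 x)

theorem maxAntichain_nonempty_iff [Finite Q] {J : LowerSet Q} :
    (maxAntichain J).1.Nonempty ↔ J ≠ ⊥ := by
  rw [← not_iff_not, Set.not_nonempty_iff_eq_empty, not_not]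
  refine ⟨fun h => ?_, ?_⟩
  · rw [← lowerClosure_maxAntichain J, h, lowerClosure_empty]
  · rintro rfl
    exact Set.eq_empty_of_forall_notMem fun x hx => hx.1

theorem maximal_starIdeal_iff (J J' : LowerSet Q) (x : Q) :
    Maximal (· ∈ starIdeal J J') x ↔
      Maximal (· ∈ J ⊓ J') x ∧ (Maximal (· ∈ J) x ∨ Maximal (· ∈ J') x) :=
  maximal_mem_lowerClosure_iff ((maxAntichain (J ⊓ J')).2.subset Set.inter_subset_left) x

theorem starIdeal_le_inf (J J' : LowerSet Q) : starIdeal J J' ≤ J ⊓ J' := by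
  intro x hx
  obtain ⟨y, hy, hxy⟩ := mem_lowerClosure.mp hx
  exact (J ⊓ J').lower hxy hy.1.1

theorem mem_eraseMaximal_iff {I : LowerSet Q} {x : Q} (hx : Maximal (· ∈ I) x) {y : Q} :
    y ∈ eraseMaximal I x hx ↔ y ∈ I ∧ y ≠ x := Iff.rfl

open Classical in
/-- The multisets `max J + max J'` and `max (J ∪ J') + max (J * J')` are equal. -/
theorem maximal_add_maximal (J J' : LowerSet Q) (x : Q) :
    ((if Maximal (· ∈ J) x then 1 else 0) + (if Maximal (· ∈ J') x then 1 else 0) : ℤ) =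
      (if Maximal (· ∈ J ⊔ J') x then 1 else 0) +
        (if Maximal (· ∈ starIdeal J J') x then 1 else 0) := by
  have hsup : Maximal (· ∈ J ⊔ J') x ↔
      (Maximal (· ∈ J) x ∨ x ∉ J) ∧ (Maximal (· ∈ J') x ∨ x ∉ J') ∧ (x ∈ J ∨ x ∈ J') := by
    constructor
    · rintro ⟨h1, h2⟩
      refine ⟨?_, ?_, h1⟩
      · exact or_iff_not_imp_right.mpr fun h => ⟨not_not.mp h, fun y hy => h2 (Or.inl hy)⟩
      · exact or_iff_not_imp_right.mpr fun h => ⟨not_not.mp h, fun y hy => h2 (Or.inr hy)⟩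
    · rintro ⟨h1, h2, h3⟩
      refine ⟨h3, ?_⟩
      rintro y (hy | hy) hxy
      · exact (h1.resolve_right fun h => h (J.lower hxy hy)).2 hy hxy
      · exact (h2.resolve_right fun h => h (J'.lower hxy hy)).2 hy hxy
  have hinf : ∀ _ : Maximal (· ∈ J) x ∨ Maximal (· ∈ J') x,
      (Maximal (· ∈ J ⊓ J') x ↔ x ∈ J ∧ x ∈ J') := fun h =>
    ⟨fun hx => hx.1, fun hx => ⟨hx, fun y hy hxy =>
      h.elim (fun h => h.2 hy.1 hxy) (fun h => h.2 hy.2 hxy)⟩⟩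
  have hm : Maximal (· ∈ J) x → x ∈ J := fun h => h.1
  have hm' : Maximal (· ∈ J') x → x ∈ J' := fun h => h.1
  rw [maximal_starIdeal_iff, hsup]
  by_cases h1 : Maximal (· ∈ J) x <;> by_cases h2 : Maximal (· ∈ J') x <;>
    by_cases h3 : x ∈ J <;> by_cases h4 : x ∈ J' <;> simp_all

end PosetIdeals

/-! ### The variables and the lattice points -/

section Variables

variable {P Q : Type*} [PartialOrder P] [PartialOrder Q]

/-- The poset ideal of `P` attached to a variable: `I` for `x_I`, and `∅` for the others. -/
def xIdeal : ToricVar P Q → LowerSet P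
  | .x I _ => I
  | .y _ _ => ⊥
  | .z => ⊥

/-- The poset ideal of `Q` attached to a variable: `J` for `y_{max J}`, and `∅` for the others. -/
def yIdeal : ToricVar P Q → LowerSet Q
  | .x _ _ => ⊥
  | .y A _ => lowerClosure A.1
  | .z => ⊥

@[simp] theorem xVar_bot : xVar Q (⊥ : LowerSet P) = .z := by simp [xVar]

theorem xVar_of_ne {I : LowerSet P} (h : I ≠ ⊥) : xVar Q I = .x I h := by simp [xVar, h]

theorem yVar_of_nonempty {A : Antichain Q} (h : A.1.Nonempty) : yVar P A = .y A h := by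
  simp [yVar, h]

theorem yVar_of_not_nonempty {A : Antichain Q} (h : ¬ A.1.Nonempty) : yVar P A = .z := by
  simp [yVar, h]

theorem xIdeal_xVar (I : LowerSet P) : xIdeal (xVar Q I) = I := by
  by_cases h : I = ⊥
  · rw [h, xVar_bot]
    rfl
  · rw [xVar_of_ne h]
    rfl

theorem yIdeal_xVar (I : LowerSet P) : yIdeal (xVar Q I) = ⊥ := by
  by_cases h : I = ⊥
  · rw [h, xVar_bot]
    rfl
  · rw [xVar_of_ne h]
    rfl

theorem yIdeal_yVar (A : Antichain Q) : yIdeal (yVar P A) = lowerClosure A.1 := by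
  by_cases h : A.1.Nonempty
  · rw [yVar_of_nonempty h]
    rfl
  · rw [yVar_of_not_nonempty h, Set.not_nonempty_iff_eq_empty.mp h, lowerClosure_empty]
    rfl

theorem xVar_xIdeal {v : ToricVar P Q} (h : xIdeal v ≠ ⊥) : xVar Q (xIdeal v) = v := by
  rcases v with ⟨I, hI⟩ | ⟨A, hA⟩ | _
  · exact xVar_of_ne hI
  · exact absurd rfl h
  · exact absurd rfl h

theorem yVar_yIdeal {v : ToricVar P Q} (h : yIdeal v ≠ ⊥) :
    yVar P (maxAntichain (yIdeal v)) = v := by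
  rcases v with ⟨I, hI⟩ | ⟨A, hA⟩ | _
  · exact absurd rfl h
  · change yVar P (maxAntichain (lowerClosure A.1)) = _
    rw [maxAntichain_lowerClosure]
    exact yVar_of_nonempty hA
  · exact absurd rfl h

variable {d : ℕ} (p : Fin d ≃ P) (q : Fin d ≃ Q)

theorem rho_bot : rho p ((⊥ : LowerSet P) : Set P) = 0 := by
  funext i
  simp [rho]

theorem varPoint_xVar (I : LowerSet P) : varPoint p q (xVar Q I) = rho p I := by
  by_cases h : I = ⊥
  · subst h
    rw [xVar_bot, rho_bot]
    rfl
  · rw [xVar_of_ne h]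
    rfl

theorem varPoint_yVar (A : Antichain Q) : varPoint p q (yVar P A) = -rho q A.1 := by
  by_cases h : A.1.Nonempty
  · rw [yVar_of_nonempty h]
    rfl
  · rw [yVar_of_not_nonempty h, Set.not_nonempty_iff_eq_empty.mp h]
    funext i
    simp [rho, varPoint]

open Classical in
theorem varPoint_apply (v : ToricVar P Q) (k : Fin d) : varPoint p q v k =
    (if p k ∈ xIdeal v then 1 else 0) - (if Maximal (· ∈ yIdeal v) (q k) then 1 else 0) := by
  rcases v with ⟨I, hI⟩ | ⟨A, hA⟩ | _
  · simp only [varPoint, rho, xIdeal, yIdeal, not_maximal_mem_bot, if_false, sub_zero,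
      SetLike.mem_coe]
    congr
  · simp only [varPoint, rho, xIdeal, yIdeal, Pi.neg_apply, maximal_mem_lowerClosure_iff A.2,
      LowerSet.notMem_bot, if_false, zero_sub]
  · simp [varPoint, xIdeal, yIdeal]

/-- The exponent vector of the Laurent monomial to which `π` sends a monomial. -/
noncomputable def imageExponent : (ToricVar P Q →₀ ℕ) →ₗ[ℕ] (Fin d → ℤ) × ℕ :=
  Finsupp.linearCombination ℕ fun v => (varPoint p q v, 1)

theorem imageExponent_single (v : ToricVar P Q) :
    imageExponent p q (Finsupp.single v 1) = (varPoint p q v, 1) := by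
  simp [imageExponent]

variable [Fintype (ToricVar P Q)]

theorem imageExponent_snd (a : ToricVar P Q →₀ ℕ) : (imageExponent p q a).2 = ∑ v, a v := by
  simp [imageExponent, Finsupp.linearCombination_apply, Finsupp.sum_fintype, Prod.snd_sum]

theorem imageExponent_fst (a : ToricVar P Q →₀ ℕ) (k : Fin d) : (imageExponent p q a).1 k =
    cover xIdeal a (p k) - peak yIdeal a (q k) := by
  classical
  simp only [imageExponent, Finsupp.linearCombination_apply, Finsupp.sum_fintype, zero_smul,
    implies_true, Prod.fst_sum, Prod.smul_fst, Finset.sum_apply, Pi.smul_apply, varPoint_apply,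
    cover, peak, Finset.sum_filter, Nat.cast_sum, ← Finset.sum_sub_distrib]
  refine Finset.sum_congr rfl fun v _ => ?_
  split_ifs <;> simp

end Variables

/-! ### The binomials as moves between monomials -/

section Moves

variable {P Q : Type*} [PartialOrder P] [PartialOrder Q] {d : ℕ}

/-- `BinomialMove p q a b c e` says that `a b - c e` is one of the binomials of `𝒢`, where
`a`, `b`, `c`, `e` are variables. -/
inductive BinomialMove (p : Fin d ≃ P) (q : Fin d ≃ Q) :
    ToricVar P Q → ToricVar P Q → ToricVar P Q → ToricVar P Q → Prop
  | xx (I I' : LowerSet P) (h : ¬ I ≤ I') (h' : ¬ I' ≤ I) :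
      BinomialMove p q (xVar Q I) (xVar Q I') (xVar Q (I ⊔ I')) (xVar Q (I ⊓ I'))
  | yy (J J' : LowerSet Q) (h : ¬ J ≤ J') (h' : ¬ J' ≤ J) :
      BinomialMove p q (yVar P (maxAntichain J)) (yVar P (maxAntichain J'))
        (yVar P (maxAntichain (J ⊔ J'))) (yVar P (maxAntichain (starIdeal J J')))
  | xy (I : LowerSet P) (J : LowerSet Q) (i : Fin d) (hI : Maximal (· ∈ I) (p i))
      (hJ : Maximal (· ∈ J) (q i)) :
      BinomialMove p q (xVar Q I) (yVar P (maxAntichain J)) (xVar Q (eraseMaximal I (p i) hI))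
        (yVar P (eraseAntichain (maxAntichain J) (q i)))

variable {p : Fin d ≃ P} {q : Fin d ≃ Q} {a b c e : ToricVar P Q}

theorem mem_binomialsG_iff {K : Type*} [Field K] {f : MvPolynomial (ToricVar P Q) K} :
    f ∈ binomialsG K p q ↔ ∃ a b c e, BinomialMove p q a b c e ∧
      f = MvPolynomial.X a * MvPolynomial.X b - MvPolynomial.X c * MvPolynomial.X e := by
  constructor
  · rintro ((⟨I, I', h, h', rfl⟩ | ⟨J, J', h, h', rfl⟩) | ⟨I, J, i, hI, hJ, rfl⟩)
    · exact ⟨_, _, _, _, .xx I I' h h', rfl⟩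
    · exact ⟨_, _, _, _, .yy J J' h h', rfl⟩
    · exact ⟨_, _, _, _, .xy I J i hI hJ, rfl⟩
  · rintro ⟨a, b, c, e, h, rfl⟩
    cases h with
    | xx I I' h h' => exact Or.inl (Or.inl ⟨I, I', h, h', rfl⟩)
    | yy J J' h h' => exact Or.inl (Or.inr ⟨J, J', h, h', rfl⟩)
    | xy I J i hI hJ => exact Or.inr ⟨I, J, i, hI, hJ, rfl⟩

theorem BinomialMove.varPoint_add (h : BinomialMove p q a b c e) :
    varPoint p q a + varPoint p q b = varPoint p q c + varPoint p q e := by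
  classical
  cases h with
  | xx I I' h h' =>
    funext k
    simp only [varPoint_xVar, Pi.add_apply, rho, SetLike.mem_coe, LowerSet.mem_sup_iff,
      LowerSet.mem_inf_iff]
    by_cases h1 : p k ∈ I <;> by_cases h2 : p k ∈ I' <;> simp [h1, h2]
  | yy J J' h h' =>
    funext k
    have := maximal_add_maximal J J' (q k)
    simp only [varPoint_yVar, Pi.add_apply, Pi.neg_apply, rho, maxAntichain, Set.mem_ofPred_eq,
      ← neg_add]
    exact congrArg Neg.neg this
  | xy I J i hI hJ =>
    funext k
    have hk : p k = p i ↔ q k = q i := p.injective.eq_iff.trans q.injective.eq_iff.symm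
    simp only [varPoint_xVar, varPoint_yVar, Pi.add_apply, Pi.neg_apply, rho, maxAntichain,
      mem_eraseMaximal_iff, eraseAntichain, Set.mem_sdiff, Set.mem_singleton_iff,
      SetLike.mem_coe, Set.mem_ofPred_eq, ne_eq, hk]
    by_cases h1 : q k = q i
    · have h2 : p k ∈ I := by
        rw [hk.mpr h1]
        exact hI.1
      have h3 : Maximal (· ∈ J) (q k) := by
        rw [h1]
        exact hJ
      simp [h1, h2, hJ]
    · simp [h1]

theorem BinomialMove.imageExponent_eq (h : BinomialMove p q a b c e) :
    imageExponent p q (.single a 1 + .single b 1) =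
      imageExponent p q (.single c 1 + .single e 1) := by
  simp only [map_add, imageExponent_single, Prod.mk_add_mk, h.varPoint_add]

variable {ord : LinearOrder (ToricVar P Q)}

/-- This needs `P` and `Q` to have the same cardinality: if `Q` were empty and `P` were not, then
nothing would force `z` to be smaller than the variables `x_I`. -/
theorem IsAdmissibleOrder.xVar_lt (ho : IsAdmissibleOrder ord) (p : Fin d ≃ P) (q : Fin d ≃ Q)
    {I' I : LowerSet P} (h : I' < I) : ord.lt (xVar Q I') (xVar Q I) := by
  let := ord
  have hI : I ≠ ⊥ := (bot_le.trans_lt h).ne'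
  by_cases hI' : I' = ⊥
  · subst hI'
    rw [xVar_bot]
    have hne : (I : Set P).Nonempty := by
      rw [Set.nonempty_iff_ne_empty, Ne, LowerSet.coe_eq_empty]
      exact hI
    obtain ⟨x, -⟩ := hne
    have hT : (⊤ : LowerSet Q) ≠ ⊥ := fun hT => by
      have hx : q (p.symm x) ∈ (⊤ : LowerSet Q) := LowerSet.mem_top
      rw [hT] at hx
      exact hx
    exact lt_trans (ho.z_lt_y ⊤ hT) (ho.y_lt_x ⊤ I hT hI)
  · exact ho.x_lt_x I' I hI' hI h

theorem IsAdmissibleOrder.yVar_lt [Finite Q] (ho : IsAdmissibleOrder ord) {J' J : LowerSet Q}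
    (h : J' < J) :
    ord.lt (yVar P (maxAntichain J')) (yVar P (maxAntichain J)) := by
  have hJ : J ≠ ⊥ := (bot_le.trans_lt h).ne'
  by_cases hJ' : J' = ⊥
  · subst hJ'
    rw [yVar_of_not_nonempty (by rw [maxAntichain_nonempty_iff]; simp)]
    exact ho.z_lt_y J hJ
  · exact ho.y_lt_y J' J hJ' hJ h

/-- One of the two variables of the trailing monomial is smaller than both variables of the leading
monomial. -/
theorem BinomialMove.lt [Finite Q] (ho : IsAdmissibleOrder ord) (h : BinomialMove p q a b c e) :
    ord.lt e a ∧ ord.lt e b := by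
  let := ord
  cases h with
  | xx I I' h h' =>
    exact ⟨ho.xVar_lt p q (inf_lt_left.mpr h), ho.xVar_lt p q (inf_lt_right.mpr h')⟩
  | yy J J' h h' =>
    have hs := starIdeal_le_inf J J'
    exact ⟨ho.yVar_lt (hs.trans_lt (inf_lt_left.mpr h)),
      ho.yVar_lt (hs.trans_lt (inf_lt_right.mpr h'))⟩
  | xy I J i hI hJ =>
    have hI' : I ≠ ⊥ := by
      rintro rfl
      exact hI.1
    have hJ' : J ≠ ⊥ := by
      rintro rfl
      exact hJ.1
    rw [← maxAntichain_lowerClosure (eraseAntichain (maxAntichain J) (q i))]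
    have hlt : lowerClosure (eraseAntichain (maxAntichain J) (q i)).1 < J := by
      refine lt_of_le_of_ne ?_ fun heq => ?_
      · intro x hx
        obtain ⟨y, hy, hxy⟩ := mem_lowerClosure.mp hx
        exact J.lower hxy hy.1.1
      · have hm := (maximal_mem_lowerClosure_iff
          (eraseAntichain (maxAntichain J) (q i)).2 (q i)).mp (by rw [heq]; exact hJ)
        exact hm.2 rfl
    have h1 := ho.yVar_lt hlt
    exact ⟨lt_trans h1 (ho.y_lt_x J I hJ' hI'), h1⟩

theorem BinomialMove.ne [Finite Q] (h : BinomialMove p q a b c e) : a ≠ b := by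
  cases h with
  | xx I I' h h' =>
    intro heq
    have := congrArg xIdeal heq
    rw [xIdeal_xVar, xIdeal_xVar] at this
    exact h this.le
  | yy J J' h h' =>
    intro heq
    have := congrArg yIdeal heq
    rw [yIdeal_yVar, yIdeal_yVar, lowerClosure_maxAntichain, lowerClosure_maxAntichain] at this
    exact h this.le
  | xy I J i hI hJ =>
    intro heq
    have := congrArg yIdeal heq
    rw [yIdeal_xVar, yIdeal_yVar, lowerClosure_maxAntichain] at this
    rw [← this] at hJ
    exact hJ.1

/-- Of two quadratic monomials, the one containing a variable smaller than both variables of the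
other is the smaller one. -/
theorem degRevLex_single_add_single_lt {σ : Type*} [Finite σ] (ord : LinearOrder σ) {a b c e : σ}
    (ha : ord.lt e a) (hb : ord.lt e b) :
    (degRevLex ord).toSyn (.single c 1 + .single e 1) <
      (degRevLex ord).toSyn (.single a 1 + .single b 1) := by
  classical
  rw [degRevLex_lt_iff]
  refine Or.inr ⟨by simp, ?_⟩
  let := ord
  have ha' : min c e < a := (min_le_right c e).trans_lt ha
  have hb' : min c e < b := (min_le_right c e).trans_lt hb
  refine ⟨min c e, fun j hj => ?_, ?_⟩
  · have hj' : j < min c e := hj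
    simp [(hj'.trans_le (min_le_left c e)).ne',
      (hj'.trans_le (min_le_right c e)).ne', (hj'.trans ha').ne', (hj'.trans hb').ne']
  · rcases min_choice c e with h | h <;> rw [h] at ha' hb' ⊢ <;>
      simp [Finsupp.single_apply, ha'.ne', hb'.ne']

end Moves

/-! ### Standard monomials -/

section Standard

open Finsupp

variable {P Q : Type*} [PartialOrder P] [PartialOrder Q] {d : ℕ}

/-- A monomial is standard if it is divisible by none of the initial monomials of `𝒢`. -/
def IsStandard (p : Fin d ≃ P) (q : Fin d ≃ Q) (u : ToricVar P Q →₀ ℕ) : Prop :=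
  ∀ a b c e, BinomialMove p q a b c e → ¬ single a 1 + single b 1 ≤ u

variable {p : Fin d ≃ P} {q : Fin d ≃ Q} {u u' : ToricVar P Q →₀ ℕ}

theorem single_add_single_le {σ : Type*} {u : σ →₀ ℕ} {a b : σ} (hab : a ≠ b) (ha : u a ≠ 0)
    (hb : u b ≠ 0) : single a 1 + single b 1 ≤ u := by
  classical
  intro v
  rw [Finsupp.add_apply, single_apply, single_apply]
  split_ifs with h1 h2 h2
  · exact absurd (h1.trans h2.symm) hab
  · subst h1
    omega
  · subst h2
    omega
  · omega

variable [Finite Q]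

theorem IsStandard.apply_eq_zero (hu : IsStandard p q u) {a b c e : ToricVar P Q}
    (h : BinomialMove p q a b c e) : u a = 0 ∨ u b = 0 := by
  by_contra! hcon
  exact hu a b c e h (single_add_single_le h.ne hcon.1 hcon.2)

theorem IsStandard.chainSupported_xIdeal (hu : IsStandard p q u) : ChainSupported xIdeal u := by
  intro v v' hv hv'
  by_contra! h
  have h1 : xIdeal v ≠ ⊥ := fun h0 => h.1 (h0 ▸ bot_le)
  have h2 : xIdeal v' ≠ ⊥ := fun h0 => h.2 (h0 ▸ bot_le)
  have := hu.apply_eq_zero (.xx _ _ h.1 h.2)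
  rw [xVar_xIdeal h1, xVar_xIdeal h2] at this
  exact this.elim hv hv'

theorem IsStandard.chainSupported_yIdeal (hu : IsStandard p q u) : ChainSupported yIdeal u := by
  intro v v' hv hv'
  by_contra! h
  have h1 : yIdeal v ≠ ⊥ := fun h0 => h.1 (h0 ▸ bot_le)
  have h2 : yIdeal v' ≠ ⊥ := fun h0 => h.2 (h0 ▸ bot_le)
  have := hu.apply_eq_zero (.yy _ _ h.1 h.2)
  rw [yVar_yIdeal h1, yVar_yIdeal h2] at this
  exact this.elim hv hv'

theorem IsStandard.peak_eq_zero [Fintype (ToricVar P Q)] (hu : IsStandard p q u) (k : Fin d) :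
    peak xIdeal u (p k) = 0 ∨ peak yIdeal u (q k) = 0 := by
  classical
  by_contra! h
  obtain ⟨v, hv, hv0⟩ := Finset.exists_ne_zero_of_sum_ne_zero h.1
  obtain ⟨v', hv', hv0'⟩ := Finset.exists_ne_zero_of_sum_ne_zero h.2
  simp only [Finset.mem_filter, Finset.mem_univ, true_and] at hv hv'
  have h1 : xIdeal v ≠ ⊥ := fun h0 => not_maximal_mem_bot (p k) (h0 ▸ hv)
  have h2 : yIdeal v' ≠ ⊥ := fun h0 => not_maximal_mem_bot (q k) (h0 ▸ hv')
  have := hu.apply_eq_zero (.xy _ _ k hv hv')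
  rw [xVar_xIdeal h1, yVar_yIdeal h2] at this
  exact this.elim hv0 hv0'

/-- Distinct standard monomials have distinct images under `π`. -/
theorem IsStandard.eq_of_imageExponent_eq [Finite P] (hu : IsStandard p q u)
    (hu' : IsStandard p q u') (h : imageExponent p q u = imageExponent p q u') : u = u' := by
  have := Fintype.ofFinite (ToricVar P Q)
  have hcx : ∀ x, cover xIdeal u x = cover xIdeal u' x := by
    refine cover_eq_of_sub_eq hu.chainSupported_xIdeal hu'.chainSupported_xIdeal
      (g := fun x => peak yIdeal u (q (p.symm x))) (g' := fun x => peak yIdeal u' (q (p.symm x)))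
      (fun x => ?_) (fun x => ?_) (fun x => ?_)
    · simpa using hu.peak_eq_zero (p.symm x)
    · simpa using hu'.peak_eq_zero (p.symm x)
    · have := congrArg (fun w => w.1 (p.symm x)) h
      simpa only [imageExponent_fst, Equiv.apply_symm_apply] using this
  have hpy : ∀ x, peak yIdeal u x = peak yIdeal u' x := by
    intro x
    have := congrArg (fun w => w.1 (q.symm x)) h
    simp only [imageExponent_fst, Equiv.apply_symm_apply, hcx] at this
    omega
  have hx := hu.chainSupported_xIdeal.eq_of_cover_eq hu'.chainSupported_xIdeal hcx
    fun v v' hv hvv' => by rw [← xVar_xIdeal hv, hvv', xVar_xIdeal (hvv' ▸ hv)]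
  have hy := hu.chainSupported_yIdeal.eq_of_cover_eq hu'.chainSupported_yIdeal
    (cover_eq_of_peak_eq hu.chainSupported_yIdeal hu'.chainSupported_yIdeal hpy)
    fun v v' hv hvv' => by rw [← yVar_yIdeal hv, hvv', yVar_yIdeal (hvv' ▸ hv)]
  have hxy : ∀ v : ToricVar P Q, v ≠ .z → u v = u' v := by
    rintro (⟨I, hI⟩ | ⟨A, hA⟩ | _) hv
    · exact hx _ hI
    · refine hy _ fun h0 => ?_
      rw [yIdeal, lowerClosure_eq_bot_iff] at h0
      exact hA.ne_empty h0
    · exact absurd rfl hv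
  -- The exponent of `z` is what remains of the total degree.
  ext v
  by_cases hv : v = .z
  · subst hv
    classical
    have hdeg := congrArg Prod.snd h
    rw [imageExponent_snd, imageExponent_snd,
      ← Finset.sum_erase_add _ (fun v => u v) (Finset.mem_univ ToricVar.z),
      ← Finset.sum_erase_add _ (fun v => u' v) (Finset.mem_univ ToricVar.z),
      Finset.sum_congr rfl fun v hv => hxy v (Finset.ne_of_mem_erase hv)] at hdeg
    exact Nat.add_left_cancel hdeg
  · exact hxy v hv

variable [Finite P] {ord : LinearOrder (ToricVar P Q)}

theorem exists_isStandard_le (ho : IsAdmissibleOrder ord) (u : ToricVar P Q →₀ ℕ) :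
    ∃ v, IsStandard p q v ∧ imageExponent p q v = imageExponent p q u ∧
      (degRevLex ord).toSyn v ≤ (degRevLex ord).toSyn u := by
  induction hs : (degRevLex ord).toSyn u using WellFoundedLT.induction generalizing u with
  | _ s ih =>
    by_cases hu : IsStandard p q u
    · exact ⟨u, hu, rfl, hs.le⟩
    · simp only [IsStandard, not_forall, not_not] at hu
      obtain ⟨a, b, c, e, h, hle⟩ := hu
      obtain ⟨w, rfl⟩ := le_iff_exists_add.mp hle
      have hlt : (degRevLex ord).toSyn (single c 1 + single e 1 + w) < s := by
        rw [← hs, map_add, map_add]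
        exact add_lt_add_left (degRevLex_single_add_single_lt ord (h.lt ho).1 (h.lt ho).2) _
      obtain ⟨v, hv, himg, hvle⟩ := ih _ hlt (single c 1 + single e 1 + w) rfl
      refine ⟨v, hv, ?_, hvle.trans hlt.le⟩
      rw [himg, map_add _ _ w, map_add _ _ w, h.imageExponent_eq]

end Standard

/-! ### The toric ideal and its Gröbner basis -/

section Toric

open MvPolynomial

variable {K : Type*} [Field K] {P Q : Type*} [PartialOrder P] [PartialOrder Q] {d : ℕ}
  (p : Fin d ≃ P) (q : Fin d ≃ Q)

theorem coe_toricMap_monomial (u : ToricVar P Q →₀ ℕ) (r : K) :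
    (toricMap K p q (monomial u r) : LaurentRing K d) =
      AddMonoidAlgebra.single (imageExponent p q u) r := by
  induction u using Finsupp.induction_linear generalizing r with
  | zero =>
    rw [map_zero, ← C_apply, ← algebraMap_eq, AlgHom.commutes]
    rfl
  | add u v hu hv =>
    have : monomial (u + v) r = monomial u r * monomial v (1 : K) := by
      rw [monomial_mul, mul_one]
    rw [this, map_mul, MulMemClass.coe_mul, hu, hv, AddMonoidAlgebra.single_mul_single, mul_one,
      map_add]
  | single v n =>
    have h1 : monomial (Finsupp.single v n) r = C r * X v ^ n := C_mul_X_pow_eq_monomial.symm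
    have h2 : Finsupp.single v n = n • Finsupp.single v 1 := by simp
    rw [h1, map_mul, map_pow, ← algebraMap_eq, AlgHom.commutes, h2, map_nsmul,
      imageExponent_single]
    change algebraMap K (LaurentRing K d) r *
      ((toricMap K p q (X v) : toricRing K (gammaPolytope p q)) : LaurentRing K d) ^ n = _
    rw [toricMap, aeval_X]
    change algebraMap K (LaurentRing K d) r *
      AddMonoidAlgebra.single (varPoint p q v, 1) 1 ^ n = _
    rw [AddMonoidAlgebra.single_pow, one_pow, ← Algebra.smul_def, AddMonoidAlgebra.smul_single,
      smul_eq_mul, mul_one]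

theorem coeff_toricMap [DecidableEq ((Fin d → ℤ) × ℕ)] (f : MvPolynomial (ToricVar P Q) K)
    (w : (Fin d → ℤ) × ℕ) : (toricMap K p q f : LaurentRing K d).coeff w =
      ∑ u ∈ f.support with imageExponent p q u = w, coeff u f := by
  conv_lhs => rw [f.as_sum]
  rw [map_sum, AddSubmonoidClass.coe_finsetSum, AddMonoidAlgebra.coeff_sum,
    Finsupp.finsetSum_apply, Finset.sum_filter]
  refine Finset.sum_congr rfl fun u _ => ?_
  rw [coe_toricMap_monomial, AddMonoidAlgebra.coeff_single, Finsupp.single_apply]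

variable {p q}

/-- In a polynomial of the toric ideal, no monomial is alone over its image. -/
theorem exists_ne_of_mem_toricIdeal {f : MvPolynomial (ToricVar P Q) K}
    (hf : f ∈ toricIdeal K p q) {u : ToricVar P Q →₀ ℕ} (hu : u ∈ f.support) :
    ∃ v ∈ f.support, v ≠ u ∧ imageExponent p q v = imageExponent p q u := by
  classical
  by_contra! hcon
  have h0 : toricMap K p q f = 0 := hf
  have h1 := coeff_toricMap p q f (imageExponent p q u)
  rw [h0, Finset.sum_eq_single_of_mem u (by simp [mem_support_iff.mp hu]) fun v hv hvu => ?_] at h1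
  · exact mem_support_iff.mp hu h1.symm
  · rw [Finset.mem_filter] at hv
    exact absurd hv.2 (hcon v hv.1 hvu)

theorem X_mul_X_eq_monomial {σ R : Type*} [CommSemiring R] (a b : σ) :
    (X a * X b : MvPolynomial σ R) = monomial (Finsupp.single a 1 + Finsupp.single b 1) 1 := by
  rw [X, X, monomial_mul, one_mul]

theorem BinomialMove.mem_toricIdeal {a b c e : ToricVar P Q} (h : BinomialMove p q a b c e) :
    (X a * X b - X c * X e : MvPolynomial (ToricVar P Q) K) ∈ toricIdeal K p q := by
  rw [toricIdeal, RingHom.mem_ker, X_mul_X_eq_monomial, X_mul_X_eq_monomial]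
  change toricMap K p q _ = 0
  rw [map_sub, sub_eq_zero]
  refine Subtype.ext ?_
  rw [coe_toricMap_monomial, coe_toricMap_monomial, h.imageExponent_eq]

theorem binomialsG_subset : binomialsG K p q ⊆ (toricIdeal K p q : Set _) := fun f hf => by
  obtain ⟨a, b, c, e, h, rfl⟩ := mem_binomialsG_iff.mp hf
  exact h.mem_toricIdeal

variable [Finite P] [Finite Q] {ord : LinearOrder (ToricVar P Q)}

theorem BinomialMove.degree_eq (ho : IsAdmissibleOrder ord) {a b c e : ToricVar P Q}
    (h : BinomialMove p q a b c e) :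
    (degRevLex ord).degree (X a * X b - X c * X e : MvPolynomial (ToricVar P Q) K) =
      .single a 1 + .single b 1 := by
  classical
  have hdeg (u : ToricVar P Q →₀ ℕ) : (degRevLex ord).degree (monomial u (1 : K)) = u := by
    rw [MonomialOrder.degree_monomial, if_neg one_ne_zero]
  rw [X_mul_X_eq_monomial, X_mul_X_eq_monomial, MonomialOrder.degree_sub_of_lt, hdeg]
  rw [hdeg, hdeg]
  exact degRevLex_single_add_single_lt ord (h.lt ho).1 (h.lt ho).2

theorem BinomialMove.ne_zero (ho : IsAdmissibleOrder ord) {a b c e : ToricVar P Q}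
    (h : BinomialMove p q a b c e) :
    (X a * X b - X c * X e : MvPolynomial (ToricVar P Q) K) ≠ 0 := by
  intro h0
  have := h.degree_eq (K := K) ho
  rw [h0, MonomialOrder.degree_zero] at this
  have hdeg := congrArg Finsupp.degree this
  simp at hdeg

/-- The initial monomial of a polynomial in the toric ideal is not standard: another monomial of
the polynomial has the same image, and hence the same standard monomial below it. -/
theorem not_isStandard_degree (ho : IsAdmissibleOrder ord) {f : MvPolynomial (ToricVar P Q) K}
    (hf : f ∈ toricIdeal K p q) (hf0 : f ≠ 0) : ¬ IsStandard p q ((degRevLex ord).degree f) := by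
  intro hst
  obtain ⟨v, hv, hne, himg⟩ :=
    exists_ne_of_mem_toricIdeal hf ((degRevLex ord).degree_mem_support hf0)
  obtain ⟨v', hv', himg', hle⟩ := exists_isStandard_le (p := p) (q := q) ho v
  have heq := hv'.eq_of_imageExponent_eq hst (himg'.trans himg)
  rw [heq] at hle
  exact hne ((degRevLex ord).toSyn.injective
    (le_antisymm ((degRevLex ord).le_degree hv) hle))

/-- The initial monomials of the binomials of `𝒢`. -/
def leadingMonomials (p : Fin d ≃ P) (q : Fin d ≃ Q) : Set (ToricVar P Q →₀ ℕ) :=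
  {u | ∃ a b c e, BinomialMove p q a b c e ∧ u = .single a 1 + .single b 1}

theorem initialIdeal_binomialsG (ho : IsAdmissibleOrder ord) :
    initialIdeal (degRevLex ord) (binomialsG K p q) =
      Ideal.span ((fun u => monomial u (1 : K)) '' leadingMonomials p q) := by
  rw [initialIdeal]
  congr 1
  ext f
  constructor
  · rintro ⟨g, hg, -, rfl⟩
    obtain ⟨a, b, c, e, h, rfl⟩ := mem_binomialsG_iff.mp hg
    exact ⟨_, ⟨a, b, c, e, h, rfl⟩, by rw [h.degree_eq ho]⟩
  · rintro ⟨_, ⟨a, b, c, e, h, rfl⟩, rfl⟩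
    exact ⟨_, mem_binomialsG_iff.mpr ⟨a, b, c, e, h, rfl⟩, h.ne_zero ho, by rw [h.degree_eq ho]⟩

theorem finite_binomialsG : (binomialsG K p q).Finite := by
  refine (Set.finite_range fun w : ToricVar P Q × ToricVar P Q × ToricVar P Q × ToricVar P Q =>
    (X w.1 * X w.2.1 - X w.2.2.1 * X w.2.2.2 : MvPolynomial (ToricVar P Q) K)).subset ?_
  intro f hf
  obtain ⟨a, b, c, e, -, rfl⟩ := mem_binomialsG_iff.mp hf
  exact ⟨(a, b, c, e), rfl⟩

theorem isGroebnerBasis_binomialsG (ho : IsAdmissibleOrder ord) :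
    IsGroebnerBasis (degRevLex ord) (binomialsG K p q) (toricIdeal K p q) where
  finite := finite_binomialsG
  ne_zero g hg := by
    obtain ⟨a, b, c, e, h, rfl⟩ := mem_binomialsG_iff.mp hg
    exact h.ne_zero ho
  subset := binomialsG_subset
  initialIdeal_eq := by
    refine le_antisymm (Ideal.span_mono ?_) ?_
    · rintro _ ⟨g, hg, h0, rfl⟩
      exact ⟨g, binomialsG_subset hg, h0, rfl⟩
    · rw [initialIdeal_binomialsG ho, initialIdeal, Ideal.span_le]
      rintro _ ⟨f, hf, hf0, rfl⟩
      have hns := not_isStandard_degree ho hf hf0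
      simp only [IsStandard, not_forall, not_not] at hns
      obtain ⟨a, b, c, e, h, hle⟩ := hns
      refine mem_ideal_span_monomial_image.mpr fun u hu => ⟨_, ⟨a, b, c, e, h, rfl⟩, ?_⟩
      rwa [Finset.mem_singleton.mp (support_monomial_subset hu)]

theorem isSquarefreeQuadraticMonomialIdeal_initialIdeal (ho : IsAdmissibleOrder ord) :
    IsSquarefreeQuadraticMonomialIdeal
      (initialIdeal (degRevLex ord) (toricIdeal K p q : Set (MvPolynomial (ToricVar P Q) K))) := by
  refine ⟨leadingMonomials p q, ?_, ?_⟩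
  · rintro _ ⟨a, b, c, e, h, rfl⟩
    refine ⟨by simp, fun v => ?_⟩
    have hle := single_add_single_le (u := Finsupp.equivFunOnFinite.symm fun _ => 1) h.ne
      (by simp) (by simp)
    simpa using hle v
  · rw [← (isGroebnerBasis_binomialsG ho).initialIdeal_eq, initialIdeal_binomialsG ho]

end Toric

/-! ### Lattice points of the polytope and surjectivity -/

section LatticePoints

variable {P Q : Type*} [PartialOrder P] [PartialOrder Q] {d : ℕ} (p : Fin d ≃ P) (q : Fin d ≃ Q)

theorem mem_Icc_and_antitone_of_mem_orderPolytope {x : Fin d → ℝ} (hx : x ∈ orderPolytope p) :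
    (∀ i, 0 ≤ x i ∧ x i ≤ 1) ∧ ∀ i j, p i ≤ p j → x j ≤ x i := by
  have hconv : Convex ℝ {x : Fin d → ℝ | (∀ i, 0 ≤ x i ∧ x i ≤ 1) ∧
      ∀ i j, p i ≤ p j → x j ≤ x i} := by
    rintro x ⟨hx1, hx2⟩ y ⟨hy1, hy2⟩ s t hs ht hst
    refine ⟨fun i => ?_, fun i j hij => ?_⟩
    · have := hx1 i
      have := hy1 i
      simp only [Pi.add_apply, Pi.smul_apply, smul_eq_mul]
      constructor <;> nlinarith
    · have := hx2 i j hij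
      have := hy2 i j hij
      simp only [Pi.add_apply, Pi.smul_apply, smul_eq_mul]
      nlinarith
  refine convexHull_min ?_ hconv hx
  rintro _ ⟨I, rfl⟩
  refine ⟨fun i => ?_, fun i j hij => ?_⟩
  · simp only [toRealVec, rho]
    split_ifs <;> norm_num
  · simp only [toRealVec, rho, SetLike.mem_coe]
    split_ifs with h1 h2 h2
    · norm_num
    · exact absurd (I.lower hij h1) h2
    · norm_num
    · norm_num

theorem mem_Icc_and_add_le_of_mem_chainPolytope {x : Fin d → ℝ} (hx : x ∈ chainPolytope q) :
    (∀ i, 0 ≤ x i ∧ x i ≤ 1) ∧ ∀ i j, q i < q j → x i + x j ≤ 1 := by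
  have hconv : Convex ℝ {x : Fin d → ℝ | (∀ i, 0 ≤ x i ∧ x i ≤ 1) ∧
      ∀ i j, q i < q j → x i + x j ≤ 1} := by
    rintro x ⟨hx1, hx2⟩ y ⟨hy1, hy2⟩ s t hs ht hst
    refine ⟨fun i => ?_, fun i j hij => ?_⟩
    · have := hx1 i
      have := hy1 i
      simp only [Pi.add_apply, Pi.smul_apply, smul_eq_mul]
      constructor <;> nlinarith
    · have := hx2 i j hij
      have := hy2 i j hij
      simp only [Pi.add_apply, Pi.smul_apply, smul_eq_mul]
      nlinarith
  refine convexHull_min ?_ hconv hx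
  rintro _ ⟨A, rfl⟩
  refine ⟨fun i => ?_, fun i j hij => ?_⟩
  · simp only [toRealVec, rho]
    split_ifs <;> norm_num
  · simp only [toRealVec, rho]
    split_ifs with h1 h2 h2
    · exact absurd (A.2.eq h1 h2 hij.le) hij.ne
    · norm_num
    · norm_num
    · norm_num

theorem exists_rho_eq_of_mem_orderPolytope {α : Fin d → ℤ}
    (hα : toRealVec α ∈ orderPolytope p) : ∃ I : LowerSet P, rho p I = α := by
  obtain ⟨h1, h2⟩ := mem_Icc_and_antitone_of_mem_orderPolytope p hα
  simp only [toRealVec] at h1 h2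
  norm_cast at h1
  simp only [Int.cast_le] at h2
  let I : LowerSet P := ⟨{x | α (p.symm x) = 1}, fun x y hyx hx => by
    have h3 := h2 (p.symm y) (p.symm x) (by simpa using hyx)
    have h4 := h1 (p.symm y)
    have h5 : α (p.symm x) = 1 := hx
    change α (p.symm y) = 1
    omega⟩
  refine ⟨I, funext fun i => ?_⟩
  have hI : p i ∈ (I : Set P) ↔ α i = 1 := by
    change α (p.symm (p i)) = 1 ↔ _
    rw [Equiv.symm_apply_apply]
  have h3 := h1 i
  rw [rho]
  split_ifs with h
  · exact (hI.mp h).symm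
  · rw [hI] at h
    omega

theorem exists_rho_eq_of_mem_chainPolytope {α : Fin d → ℤ}
    (hα : toRealVec α ∈ chainPolytope q) : ∃ A : Antichain Q, rho q A.1 = α := by
  obtain ⟨h1, h2⟩ := mem_Icc_and_add_le_of_mem_chainPolytope q hα
  simp only [toRealVec] at h1 h2
  norm_cast at h1
  norm_cast at h2
  refine ⟨⟨{x | α (q.symm x) = 1}, fun x hx y hy hne hle => ?_⟩, ?_⟩
  · have h3 := h2 (q.symm x) (q.symm y) (by simpa using lt_of_le_of_ne hle hne)
    have h4 : α (q.symm x) = 1 := hx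
    have h5 : α (q.symm y) = 1 := hy
    omega
  · funext i
    have h3 := h1 i
    by_cases h : α i = 1
    · simp [rho, h]
    · have h0 : α i = 0 := by omega
      simp [rho, h0]

/-- The lattice points of the polytope are those that belong to the variables. -/
theorem exists_varPoint_eq_of_mem_gammaPolytope {α : Fin d → ℤ}
    (hα : toRealVec α ∈ gammaPolytope p q) : ∃ v : ToricVar P Q, varPoint p q v = α := by
  have hO : (orderPolytope p).Nonempty := ⟨_, subset_convexHull _ _ ⟨⊥, rfl⟩⟩
  have hC : (chainPolytope q).Nonempty :=
    ⟨_, subset_convexHull _ _ ⟨⟨∅, Set.pairwise_empty _⟩, rfl⟩⟩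
  have hCneg : Convex ℝ (Neg.neg '' chainPolytope q) := by
    rw [Set.image_neg_eq_neg]
    exact (convex_convexHull ℝ _).neg
  have hOconv : Convex ℝ (orderPolytope p) := convex_convexHull ℝ _
  rw [gammaPolytope, hOconv.convexHull_union hCneg hO (hC.image _), mem_convexJoin] at hα
  obtain ⟨x, hx, _, ⟨y, hy, rfl⟩, s, t, hs, ht, hst, hxy⟩ := hα
  rcases hs.eq_or_lt with rfl | hs
  · have : toRealVec (-α) = y := by
      rw [zero_add] at hst
      subst hst
      rw [zero_smul, one_smul, zero_add] at hxy
      funext i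
      have hi := congrFun hxy i
      simp only [toRealVec, Pi.neg_apply, Int.cast_neg] at hi ⊢
      linarith
    obtain ⟨A, hA⟩ := exists_rho_eq_of_mem_chainPolytope q (this ▸ hy)
    exact ⟨yVar P A, by rw [varPoint_yVar, hA, neg_neg]⟩
  rcases ht.eq_or_lt with rfl | ht
  · rw [add_zero] at hst
    subst hst
    rw [zero_smul, one_smul, add_zero] at hxy
    obtain ⟨I, hI⟩ := exists_rho_eq_of_mem_orderPolytope p (hxy ▸ hx)
    exact ⟨xVar Q I, by rw [varPoint_xVar, hI]⟩
  -- Strictly between the two polytopes all coordinates have absolute value less than one.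
  · refine ⟨.z, funext fun i => ?_⟩
    have hi := congrFun hxy i
    simp only [Pi.add_apply, Pi.smul_apply, Pi.neg_apply, smul_eq_mul, toRealVec] at hi
    have h1 := (mem_Icc_and_antitone_of_mem_orderPolytope p hx).1 i
    have h2 := (mem_Icc_and_add_le_of_mem_chainPolytope q hy).1 i
    have h3 : (α i : ℝ) < 1 := by nlinarith
    have h4 : (-1 : ℝ) < α i := by nlinarith
    have h5 : α i < 1 := by exact_mod_cast h3
    have h6 : -1 < α i := by exact_mod_cast h4
    change 0 = α i
    omega

theorem toricMap_surjective (K : Type*) [Field K] : Function.Surjective (toricMap K p q) := by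
  have hle : toricRing K (gammaPolytope p q) ≤
      ((toricRing K (gammaPolytope p q)).val.comp (toricMap K p q)).range := by
    refine Algebra.adjoin_le ?_
    rintro _ ⟨α, hα, rfl⟩
    obtain ⟨v, rfl⟩ := exists_varPoint_eq_of_mem_gammaPolytope p q hα
    refine ⟨MvPolynomial.X v, ?_⟩
    simp [toricMap]
  rintro ⟨f, hf⟩
  obtain ⟨g, hg⟩ := hle hf
  exact ⟨g, Subtype.ext hg⟩

end LatticePoints

/-! ### Existence of an admissible order -/

section AdmissibleOrder

variable {P Q : Type*} [PartialOrder P] [PartialOrder Q]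

/-- A sorting key for an admissible order of the variables: the kind of the variable, then
linear extensions of the inclusion orders of the poset ideals. -/
noncomputable def toricVarKey (v : ToricVar P Q) :
    ℕ ×ₗ (LinearExtension (LowerSet P) ×ₗ LinearExtension (LowerSet Q)) :=
  toLex (match v with
    | .x _ _ => 2
    | .y _ _ => 1
    | .z => 0, toLex (toLinearExtension (xIdeal v), toLinearExtension (yIdeal v)))

theorem toLinearExtension_injective {α : Type*} [PartialOrder α] :
    Function.Injective (toLinearExtension : α →o LinearExtension α) := fun _ _ h => h

theorem toricVarKey_injective : Function.Injective (toricVarKey (P := P) (Q := Q)) := by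
  intro v v' h
  simp only [toricVarKey, EmbeddingLike.apply_eq_iff_eq, Prod.mk.injEq,
    toLinearExtension_injective.eq_iff] at h
  obtain ⟨h0, h1, h2⟩ := h
  rcases v with ⟨I, hI⟩ | ⟨A, hA⟩ | _ <;> rcases v' with ⟨I', hI'⟩ | ⟨A', hA'⟩ | _ <;>
    simp only [OfNat.ofNat_ne_one, OfNat.one_ne_ofNat, OfNat.ofNat_ne_zero,
      OfNat.zero_ne_ofNat, one_ne_zero, zero_ne_one] at h0 ⊢
  · have : I = I' := h1
    subst this
    rfl
  · have := congrArg maxAntichain h2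
    simp only [yIdeal, maxAntichain_lowerClosure] at this
    subst this
    rfl

theorem exists_isAdmissibleOrder [Finite Q] :
    ∃ ord : LinearOrder (ToricVar P Q), IsAdmissibleOrder ord := by
  refine ⟨LinearOrder.lift' toricVarKey toricVarKey_injective, ?_, ?_, ?_, ?_⟩
  · intro J hJ
    change toricVarKey _ < toricVarKey _
    rw [yVar_of_nonempty (maxAntichain_nonempty_iff.mpr hJ), toricVarKey, toricVarKey,
      Prod.Lex.toLex_lt_toLex]
    exact Or.inl zero_lt_one
  · intro J I hJ hI
    change toricVarKey _ < toricVarKey _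
    rw [yVar_of_nonempty (maxAntichain_nonempty_iff.mpr hJ), xVar_of_ne hI, toricVarKey,
      toricVarKey, Prod.Lex.toLex_lt_toLex]
    exact Or.inl one_lt_two
  · intro I' I hI' hI hlt
    change toricVarKey _ < toricVarKey _
    rw [xVar_of_ne hI', xVar_of_ne hI, toricVarKey, toricVarKey, Prod.Lex.toLex_lt_toLex,
      Prod.Lex.toLex_lt_toLex]
    exact Or.inr ⟨rfl, Or.inl
      (toLinearExtension.monotone.strictMono_of_injective toLinearExtension_injective hlt)⟩
  · intro J' J hJ' hJ hlt
    change toricVarKey _ < toricVarKey _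
    rw [yVar_of_nonempty (maxAntichain_nonempty_iff.mpr hJ'),
      yVar_of_nonempty (maxAntichain_nonempty_iff.mpr hJ), toricVarKey, toricVarKey,
      Prod.Lex.toLex_lt_toLex, Prod.Lex.toLex_lt_toLex]
    refine Or.inr ⟨rfl, Or.inr ⟨rfl, ?_⟩⟩
    simp only [yIdeal, lowerClosure_maxAntichain]
    exact toLinearExtension.monotone.strictMono_of_injective toLinearExtension_injective hlt

end AdmissibleOrder

theorem theorem1p1 {K : Type*} [Field K] {d : ℕ} {P Q : Type*} [PartialOrder P] [PartialOrder Q]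
    [Finite P] [Finite Q] (p : Fin d ≃ P) (q : Fin d ≃ Q) :
    Function.Surjective (toricMap K p q) ∧
    (∃ ord : LinearOrder (ToricVar P Q), IsAdmissibleOrder ord) ∧
    ∀ ord : LinearOrder (ToricVar P Q), IsAdmissibleOrder ord →
      IsGroebnerBasis (degRevLex ord) (binomialsG K p q) (toricIdeal K p q) ∧
      IsSquarefreeQuadraticMonomialIdeal
        (initialIdeal (degRevLex ord)
          (toricIdeal K p q : Set (MvPolynomial (ToricVar P Q) K))) :=
  ⟨toricMap_surjective p q K, exists_isAdmissibleOrder, fun _ ho =>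
    ⟨isGroebnerBasis_binomialsG ho, isSquarefreeQuadraticMonomialIdeal_initialIdeal ho⟩⟩
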